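/- For integers $m,n\ge 1$ consider elections with candidate set $[m]$ and $n$ votes. In *plurality*, each vote is a complete ranking of $[m]$, the score of a candidate is the number of votes that rank it first, and the candidates of maximum score are the winners. In *generalized plurality*, each vote is an approval or a disapproval of a single candidate, the score of a candidate is the number of its approvals minus the number of its disapprovals, and the candidates of maximum score are the winners. For $\varepsilon\ge 0$, a candidate $w$ is an *$\varepsilon$-winner* of an $n$-vote profile if $w$ can be made a winner by changing at most $\varepsilon n$ votes; in particular the $0$-winners are exactly the winners. A *one-pass algorithm with $s$ bits of memory* is a randomized algorithm that reads the votes one by one, once and in the given order, keeps only $s$ bits of memory between consecutive votes, and outputs a candidate computed from its final memory content; access to its internal coin tosses and to the position in the stream is not charged, and it may depend on $m$ and $n$. It is an *$(\varepsilon,\delta)$-winner determination algorithm* for $m$ candidates and $n$ votes if, on every stream of $n$ votes over $[m]$, it outputs an $\varepsilon$-winner with probability at least $1-\delta$ over its coin tosses. **Theorem.** Let $\delta\in[0,1)$. Any one-pass $(0,\delta)$-winner determination algorithm for plurality, and any such algorithm for generalized plurality, must use $\Omega(\min\{m,n\})$ bits of memory. That is, there are a constant $c>0$ and an integer $N_0$,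 depending only on $\delta$, such that for all $m,n$ with $\min\{m,n\}\ge N_0$, every one-pass $(0,\delta)$-winner determination algorithm for $m$ candidates and $n$ votes, for plurality or for generalized plurality, uses $s\ge c\min\{m,n\}$ bits of memory. -/

import Mathlib

namespace VoteStream

/-- A voting rule on ballots of type `V` and candidates `C`: it assigns to each profile of `n`
ballots (for every number `n` of voters) the set of winners. -/
abbrev VotingRule (V C : Type*) := (n : ℕ) → (Fin n → V) → Set C

/-- The candidates of maximum score. -/
def maxScorers {C : Type*} (score : C → ℤ) : Set C := {w | ∀ c, score c ≤ score w}

/-- A complete strict ranking of the candidates `0, …, m - 1`: `v i` is the candidate placed at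
position `i` (position `0` is the top). -/
abbrev Ranking (m : ℕ) := Equiv.Perm (Fin m)

/-- The positional scoring rule of a score vector `α`: a candidate receives `α i` points from every
ballot that places it at position `i`, and the candidates of maximum total score win. -/
def scoringRule {m : ℕ} (α : Fin m → ℤ) : VotingRule (Ranking m) (Fin m) :=
  fun n σ => maxScorers fun c => ∑ i : Fin n, α ((σ i).symm c)

/-- `k`-approval: the scoring rule with `1` in the first `k` positions and `0` elsewhere. -/
def kApproval (m k : ℕ) : VotingRule (Ranking m) (Fin m) :=
  scoringRule fun i => if (i : ℕ) < k then 1 else 0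

/-- Plurality is `1`-approval. -/
def plurality (m : ℕ) : VotingRule (Ranking m) (Fin m) := kApproval m 1

/-- A ballot of generalized plurality: an approval or a disapproval of a single candidate. -/
inductive GenBallot (m : ℕ) where
  | approve (c : Fin m)
  | disapprove (c : Fin m)

/-- Generalized plurality: the score of a candidate is the number of its approvals minus the number
of its disapprovals, and the candidates of maximum score win. -/
def generalizedPlurality (m : ℕ) : VotingRule (GenBallot m) (Fin m) :=
  fun n σ => maxScorers fun c =>
    ({i : Fin n | σ i = .approve c}.ncard : ℤ) - ({i : Fin n | σ i = .disapprove c}.ncard : ℤ)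

/-- `w` is an `ε`-winner of the `n`-vote profile `σ` if it becomes a winner after a suitable change
of at most `ε n` of the votes. -/
def IsEpsWinner {V C : Type*} (r : VotingRule V C) (ε : ℝ) {n : ℕ} (σ : Fin n → V) (w : C) : Prop :=
  ∃ τ : Fin n → V, ({i | τ i ≠ σ i}.ncard : ℝ) ≤ ε * n ∧ w ∈ r n τ

/-- A content of a memory of `s` bits. -/
abbrev Memory (s : ℕ) := Fin s → Bool

/-- A randomized one-pass algorithm with `s` bits of memory that reads a stream over `V` and
outputs an element of `C`; `Ω` is the space of outcomes of its internal coin tosses. The memory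
content after an item depends on nothing but the content before it, the item, the coins and the
position of the item in the stream. No restriction on computing time is imposed, and access to the
coins and to the position is not charged as memory, so this class contains the algorithms that have
to keep a counter or earlier coin tosses in their `s` bits. -/
structure OnePassAlgorithm (V C : Type*) (s : ℕ) (Ω : Type*) [MeasurableSpace Ω] where
  /-- initial memory content -/
  init : Ω → Memory s
  /-- `step k ω v q`: new memory content when item number `k` is `v` and the content is `q` -/
  step : ℕ → Ω → V → Memory s → Memory s
  /-- output, computed from the final memory content -/
  output : Ω → Memory s → C
  measurableSet_init : ∀ q, MeasurableSet {ω | init ω = q}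
  measurableSet_step : ∀ k v q q', MeasurableSet {ω | step k ω v q = q'}
  measurableSet_output : ∀ q c, MeasurableSet {ω | output ω q = c}

namespace OnePassAlgorithm

variable {V C Ω : Type*} {s : ℕ} [MeasurableSpace Ω]

/-- The memory content after the stream `σ 0, …, σ (n - 1)` has been read once, in this order. -/
def finalMemory (A : OnePassAlgorithm V C s Ω) {n : ℕ} (σ : Fin n → V) (ω : Ω) : Memory s :=
  Fin.foldl n (fun q i => A.step i ω (σ i) q) (A.init ω)

/-- The output of the algorithm on the stream `σ` with coin tosses `ω`. -/
def result (A : OnePassAlgorithm V C s Ω) {n : ℕ} (σ : Fin n → V) (ω : Ω) : C :=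
  A.output ω (A.finalMemory σ ω)

/-- `A` solves `(ε, δ)`-winner determination for the rule `r` on streams of `n` votes: on every such
stream it outputs an `ε`-winner with probability at least `1 - δ` over its coin tosses. -/
def SolvesWinnerDetermination (A : OnePassAlgorithm V C s Ω) (μ : MeasureTheory.Measure Ω)
    (r : VotingRule V C) (n : ℕ) (ε δ : ℝ) : Prop :=
  ∀ σ : Fin n → V, 1 - δ ≤ μ.real {ω | IsEpsWinner r ε σ (A.result σ ω)}

end OnePassAlgorithm

end VoteStream

/-!
The lower bound is a reduction from the one-way communication problem INDEX over an alphabet of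
constant size `t ≈ 4 / (1 - δ)`. Fix `k · t` candidates `(j, a)` with `j < k`, `a < t`. A word
`x ∈ [t]^k` is encoded by a first part of the stream that contains two votes for `(j, x j)`, for
every `j`. An index `i` is encoded by a second part that votes for `(i, 0), …, (i, t - 1)` in turn,
as often as needed to reach `n` votes. In the second part the scores of the candidates `(i, a)`
differ by at most one, and all other candidates score zero, so `(i, x i)` is the only winner of the
whole stream (`card_hardStream_lt`). Hence an algorithm that determines winners recovers `x i` from
`i` and the memory content after the first part, with probability at least `p = 1 - δ`.

A large alphabet is what makes the argument work for every `δ < 1`: guessing a letter succeeds with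
probability `1 / t`, which is well below `p`. To bound the memory, fix the coins so that the
expected number of recovered letters, for a uniformly random word, is at least `p k`
(`exists_mul_card_le_sum_indicator`). For any one memory content, the exponential of the number of
recovered letters has mean at most `((t - 1 + e) / t)^k ≤ e^(2k/t)`; summing over the `2^s` contents
and using convexity of `exp` gives `e^(pk) ≤ 2^s e^(2k/t)`, so that `s ≥ p k / 2` because
`2 / t ≤ p / 2` (`index_lower_bound`). Finally, `k` can be chosen proportional to `min m n`.

Both voting rules are covered at once: all that matters is a ballot for each candidate
such that on profiles of these ballots the rule elects the candidates named most often.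
-/

open MeasureTheory Finset

namespace VoteStream

/-! ### The communication complexity of INDEX over a large alphabet -/

/-- Averaging: if each of finitely many events has probability at least `p`, then some outcome lies
in at least a fraction `p` of them. -/
theorem exists_mul_card_le_sum_indicator {J Ω : Type*} [Fintype J] [MeasurableSpace Ω]
    (μ : Measure Ω) [IsProbabilityMeasure μ] (S : J → Set Ω) (hS : ∀ j, MeasurableSet (S j))
    (p : ℝ) (hp : ∀ j, p ≤ μ.real (S j)) :
    ∃ ω, p * Fintype.card J ≤ ∑ j, (S j).indicator (fun _ => (1 : ℝ)) ω := by
  have hint : ∀ j, Integrable ((S j).indicator fun _ => (1 : ℝ)) μ := fun j =>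
    (integrable_const 1).indicator (hS j)
  obtain ⟨ω, hω⟩ := exists_integral_le (μ := μ) (integrable_finsetSum univ fun j _ => hint j)
  refine ⟨ω, le_trans ?_ hω⟩
  rw [integral_finsetSum _ fun j _ => hint j]
  calc p * Fintype.card J = ∑ _j : J, p := by simp [mul_comm]
    _ ≤ _ := sum_le_sum fun j _ => by
      rw [integral_indicator_const _ (hS j)]
      simpa using hp j

/-- For a random word, the exponential moment of the number of letters agreeing with a fixed
guess factors over the letters. -/
theorem sum_exp_agree_le {α C : Type*} [Fintype α] [DecidableEq C] {k : ℕ}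
    (g : Fin k → α → C) (hg : ∀ i, Function.Injective (g i)) (y : Fin k → C) :
    ∑ x : Fin k → α, Real.exp (∑ i, if y i = g i (x i) then 1 else 0) ≤
      (Fintype.card α + 2 : ℝ) ^ k := by
  classical
  have he : Real.exp 1 ≤ 3 := by linarith [Real.exp_one_lt_d9]
  simp_rw [Real.exp_sum]
  rw [← Fintype.prod_sum fun i a => Real.exp (if y i = g i a then 1 else 0)]
  have hletter : ∀ i, ∑ a, Real.exp (if y i = g i a then 1 else 0) ≤ Fintype.card α + 2 := by
    intro i
    have hle : ∀ a, Real.exp (if y i = g i a then 1 else 0) ≤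
        1 + 2 * (if y i = g i a then 1 else 0) := by
      intro a
      split_ifs
      · linarith
      · simp
    have hone : ∑ a, (if y i = g i a then (1 : ℝ) else 0) ≤ 1 := by
      rw [sum_boole]
      exact_mod_cast card_le_one.2 fun a ha b hb =>
        by
        simp only [mem_filter, mem_univ, true_and] at ha hb
        exact hg i (ha.symm.trans hb)
    calc _ ≤ ∑ a, (1 + 2 * (if y i = g i a then (1 : ℝ) else 0)) := sum_le_sum fun a _ => hle a
      _ = Fintype.card α + 2 * ∑ a, (if y i = g i a then (1 : ℝ) else 0) := by
        rw [sum_add_distrib, ← mul_sum]; simp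
      _ ≤ _ := by linarith
  calc _ ≤ ∏ _i : Fin k, (Fintype.card α + 2 : ℝ) :=
        prod_le_prod (fun i _ => sum_nonneg fun a _ => (Real.exp_pos _).le) fun i _ => hletter i
    _ = _ := by simp

/-- If `x ↦ M x` compresses words of length `k` to `s` bits and the decoder `D` recovers, over all
words and positions, at least a fraction `p` of the letters, then `s ≥ p k / 2`, provided that the
alphabet has at least `4 / p` letters. The injections `g i` translate letters into outputs. -/
theorem index_lower_bound {α C : Type*} [Fintype α] [Nonempty α] [DecidableEq C] {k s : ℕ}
    (g : Fin k → α → C) (hg : ∀ i, Function.Injective (g i))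
    (M : (Fin k → α) → Memory s) (D : Memory s → Fin k → C) (p : ℝ)
    (hα : 4 ≤ p * Fintype.card α)
    (h : p * (Fintype.card (Fin k → α) * k : ℝ) ≤
      ∑ x, ∑ i, if D (M x) i = g i (x i) then (1 : ℝ) else 0) :
    p * k / 2 ≤ s := by
  classical
  set t : ℝ := (Fintype.card α : ℝ) with ht
  have ht0 : 0 < t := by rw [ht]; exact_mod_cast Fintype.card_pos
  have hN : (Fintype.card (Fin k → α) : ℝ) = t ^ k := by simp [ht]
  set a : (Fin k → α) → ℝ := fun x => ∑ i, if D (M x) i = g i (x i) then (1 : ℝ) else 0 with ha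
  -- The tangent of `exp` at `p * k` stands in for Jensen's inequality.
  have hlow : Real.exp (p * k) * t ^ k ≤ ∑ x, Real.exp (a x) := by
    calc Real.exp (p * k) * t ^ k
        ≤ Real.exp (p * k) * ∑ x, (a x - p * k + 1) := by
          gcongr
          rw [sum_add_distrib, sum_sub_distrib]
          simp only [sum_const, card_univ, nsmul_eq_mul, hN]
          rw [hN] at h
          linarith
      _ = ∑ x, Real.exp (p * k) * (a x - p * k + 1) := mul_sum ..
      _ ≤ ∑ x, Real.exp (a x) := sum_le_sum fun x _ => by
          calc _ ≤ Real.exp (p * k) * Real.exp (a x - p * k) := by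
                gcongr; exact Real.add_one_le_exp _
            _ = _ := by rw [← Real.exp_add]; ring_nf
  have hupp : ∑ x, Real.exp (a x) ≤ 2 ^ s * (t + 2) ^ k := by
    calc ∑ x, Real.exp (a x)
        ≤ ∑ x : Fin k → α, ∑ q : Memory s,
            Real.exp (∑ i, if D q i = g i (x i) then (1 : ℝ) else 0) :=
          sum_le_sum fun x _ => single_le_sum
            (f := fun q => Real.exp (∑ i, if D q i = g i (x i) then (1 : ℝ) else 0))
            (fun q _ => (Real.exp_pos _).le) (mem_univ (M x))
      _ = ∑ q : Memory s, ∑ x : Fin k → α,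
            Real.exp (∑ i, if D q i = g i (x i) then (1 : ℝ) else 0) := sum_comm
      _ ≤ ∑ _q : Memory s, (t + 2) ^ k := sum_le_sum fun q _ => sum_exp_agree_le g hg (D q)
      _ = _ := by simp
  have hpow : (t + 2) ^ k ≤ t ^ k * Real.exp (p * k / 2) := by
    have h1 : t + 2 ≤ t * Real.exp (p / 2) := by
      nlinarith [Real.add_one_le_exp (p / 2)]
    calc (t + 2) ^ k ≤ (t * Real.exp (p / 2)) ^ k := by gcongr
      _ = _ := by rw [mul_pow, ← Real.exp_nat_mul]; ring_nf
  have htwo : (2 : ℝ) ^ s ≤ Real.exp s := by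
    calc (2 : ℝ) ^ s ≤ Real.exp 1 ^ s := by
          gcongr; linarith [Real.add_one_le_exp (1 : ℝ)]
      _ = _ := by rw [← Real.exp_nat_mul]; simp
  have hfin : Real.exp (p * k) * t ^ k ≤ Real.exp (s + p * k / 2) * t ^ k := by
    calc _ ≤ (2 : ℝ) ^ s * (t + 2) ^ k := hlow.trans hupp
      _ ≤ Real.exp s * (t ^ k * Real.exp (p * k / 2)) := by gcongr
      _ = _ := by rw [Real.exp_add]; ring
  have := Real.exp_le_exp.1 (le_of_mul_le_mul_right hfin (by positivity))
  linarith

/-! ### Runs of one-pass algorithms -/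

namespace OnePassAlgorithm

variable {V C Ω : Type*} {s : ℕ} [MeasurableSpace Ω]

theorem measurable_foldl_step (A : OnePassAlgorithm V C s Ω) (n : ℕ) (σ : Fin n → V)
    (f : Ω → Memory s) (hf : Measurable f) :
    Measurable fun ω => Fin.foldl n (fun q i => A.step i ω (σ i) q) (f ω) := by
  induction n with
  | zero => simpa using hf
  | succ n ih =>
    refine measurable_to_countable' fun q' => ?_
    have : (fun ω => Fin.foldl (n + 1) (fun q i => A.step i ω (σ i) q) (f ω)) ⁻¹' {q'} =
        ⋃ q, ((fun ω => Fin.foldl n (fun q i => A.step i ω (σ i.castSucc) q) (f ω)) ⁻¹' {q}) ∩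
          {ω | A.step n ω (σ (Fin.last n)) q = q'} := by
      ext ω
      simp [Fin.foldl_succ_last]
    rw [this]
    exact MeasurableSet.iUnion fun q =>
      (ih (fun i => σ i.castSucc) (measurableSet_singleton q)).inter (A.measurableSet_step _ _ _ _)

theorem measurable_init (A : OnePassAlgorithm V C s Ω) : Measurable A.init :=
  measurable_to_countable' A.measurableSet_init

theorem measurableSet_result_eq (A : OnePassAlgorithm V C s Ω) {n : ℕ} (σ : Fin n → V) (c : C) :
    MeasurableSet {ω | A.result σ ω = c} := by
  have : {ω | A.result σ ω = c} =
      ⋃ q, (A.finalMemory σ ⁻¹' {q}) ∩ {ω | A.output ω q = c} := by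
    ext ω
    simp [result]
  rw [this]
  exact MeasurableSet.iUnion fun q =>
    (A.measurable_foldl_step n σ A.init A.measurable_init (measurableSet_singleton q)).inter
      (A.measurableSet_output _ _)

/-- After a first part of the stream, the output depends on this part through the memory content
only. -/
theorem result_append (A : OnePassAlgorithm V C s Ω) {l r : ℕ} (σ : Fin l → V) (τ : Fin r → V)
    (ω : Ω) :
    A.result (Fin.append σ τ) ω =
      A.output ω (Fin.foldl r (fun q i => A.step (l + i) ω (τ i) q) (A.finalMemory σ ω)) := by
  simp [result, finalMemory, Fin.foldl_add]

end OnePassAlgorithm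

theorem isEpsWinner_zero_iff {V C : Type*} (r : VotingRule V C) {n : ℕ} (σ : Fin n → V) (w : C) :
    IsEpsWinner r 0 σ w ↔ w ∈ r n σ := by
  constructor
  · rintro ⟨τ, hτ, hw⟩
    have h0 : {i | τ i ≠ σ i}.ncard = 0 := by
      have : ({i | τ i ≠ σ i}.ncard : ℝ) ≤ 0 := by simpa using hτ
      exact_mod_cast le_antisymm this (Nat.cast_nonneg _)
    have : τ = σ := by
      rw [Set.ncard_eq_zero (Set.toFinite _), Set.eq_empty_iff_forall_notMem] at h0
      funext i
      simpa using h0 i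
    exact this ▸ hw
  · exact fun hw => ⟨σ, by simp, hw⟩

/-! ### The hard streams -/

theorem comp_append {C V : Type*} {l r : ℕ} (f : C → V) (σ : Fin l → C) (τ : Fin r → C) :
    f ∘ Fin.append σ τ = Fin.append (f ∘ σ) (f ∘ τ) := by
  funext i
  refine Fin.addCases (fun i => ?_) (fun i => ?_) i <;> simp

theorem card_filter_append {C : Type*} [DecidableEq C] {l r : ℕ} (σ : Fin l → C) (τ : Fin r → C)
    (c : C) :
    #{i | Fin.append σ τ i = c} = #{i | σ i = c} + #{i | τ i = c} := by
  simp only [card_filter, Fin.sum_univ_add, Fin.append_left, Fin.append_right]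

/-- The second part of a hard stream: `r` votes that run through the candidates `(i, a)`, `a < t`,
in a round robin. -/
def roundRobin {C : Type*} {k t : ℕ} (e : Fin k × Fin t → C) (ht : 0 < t) (r : ℕ) (i : Fin k) :
    Fin r → C :=
  fun b => e (i, ⟨b % t, Nat.mod_lt _ ht⟩)

theorem card_roundRobin {C : Type*} [DecidableEq C] {k t : ℕ} (e : Fin k × Fin t → C)
    (he : Function.Injective e) (ht : 0 < t) (r : ℕ) (i : Fin k) (a : Fin t) :
    #{b | roundRobin e ht r i b = e (i, a)} = r / t + if (a : ℕ) < r % t then 1 else 0 := by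
  have h := Nat.count_modEq_card r ht a
  rw [Nat.mod_eq_of_lt a.2, Nat.count_eq_card_filter_range, card_filter, sum_range] at h
  rw [← h, card_filter]
  simp [roundRobin, he.eq_iff, Fin.ext_iff, Nat.ModEq, Nat.mod_eq_of_lt a.2]

/-- The hard stream for the word `x` and the index `i`: two votes for each `(j, x j)`, then a round
robin over the candidates `(i, a)`. -/
def hardStream {C : Type*} {k t : ℕ} (e : Fin k × Fin t → C) (ht : 0 < t) (r : ℕ)
    (x : Fin k → Fin t) (i : Fin k) : Fin (k + k + r) → C :=
  Fin.append (Fin.append (fun j => e (j, x j)) fun j => e (j, x j)) (roundRobin e ht r i)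

/-- In a hard stream, the candidate `(i, x i)` is named more often than every other one. -/
theorem card_hardStream_lt {C : Type*} [DecidableEq C] {k t : ℕ} (e : Fin k × Fin t → C)
    (he : Function.Injective e) (ht : 0 < t) {r : ℕ} (hr : t ≤ r) (x : Fin k → Fin t) (i : Fin k)
    (c : C) (hc : c ≠ e (i, x i)) :
    #{b | hardStream e ht r x i b = c} < #{b | hardStream e ht r x i b = e (i, x i)} := by
  have hq : 1 ≤ r / t := (Nat.one_le_div_iff ht).2 hr
  have hw : 1 ≤ #{j | e (j, x j) = e (i, x i)} := card_pos.2 ⟨i, by simp⟩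
  have hcount : ∀ d, #{b | hardStream e ht r x i b = d} =
      #{j | e (j, x j) = d} + #{j | e (j, x j) = d} + #{b | roundRobin e ht r i b = d} :=
    fun d => (card_filter_append _ _ d).trans (by rw [card_filter_append])
  rw [hcount, hcount, card_roundRobin e he ht r i (x i)]
  by_cases hci : ∃ a, c = e (i, a)
  · obtain ⟨a, rfl⟩ := hci
    have h0 : #{j | e (j, x j) = e (i, a)} = 0 := by
      rw [card_eq_zero, filter_eq_empty_iff]
      intro j _ hj
      have := he hj
      simp only [Prod.mk.injEq] at this
      obtain ⟨rfl, rfl⟩ := this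
      exact hc rfl
    rw [h0, card_roundRobin e he ht r i a]
    split_ifs <;> omega
  · have h0 : #{b | roundRobin e ht r i b = c} = 0 := by
      rw [card_eq_zero, filter_eq_empty_iff]
      exact fun b _ hb => hci ⟨_, hb.symm⟩
    have h1 : #{j | e (j, x j) = c} ≤ 1 := card_le_one.2 fun j hj j' hj' => by
      have := he ((mem_filter.1 hj).2.trans (mem_filter.1 hj').2.symm)
      exact (Prod.mk.inj this).1
    rw [h0]
    omega

/-! ### The reduction -/

/-- The memory bound for every rule with a ballot `vote c` for each candidate `c` such that on
profiles of these ballots the candidates named most often win. -/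
theorem memory_lower_bound {V C Ω : Type*} [DecidableEq C] [MeasurableSpace Ω] (μ : Measure Ω)
    [IsProbabilityMeasure μ] (R : VotingRule V C) (vote : C → V)
    (hR : ∀ (n : ℕ) (τ : Fin n → C) (w : C),
      w ∈ R n (vote ∘ τ) → ∀ c, #{i | τ i = c} ≤ #{i | τ i = w})
    {k t r s : ℕ} (e : Fin k × Fin t → C) (he : Function.Injective e) (ht : 0 < t) (hr : t ≤ r)
    {δ : ℝ} (hδ : 4 ≤ (1 - δ) * t) (A : OnePassAlgorithm V C s Ω)
    (hA : A.SolvesWinnerDetermination μ R (k + k + r) 0 δ) :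
    (1 - δ) * k / 2 ≤ s := by
  classical
  have : Nonempty (Fin t) := ⟨⟨0, ht⟩⟩
  set a : (Fin k → Fin t) → Fin (k + k) → V := fun x =>
    vote ∘ Fin.append (fun j => e (j, x j)) fun j => e (j, x j) with ha
  set b : Fin k → Fin r → V := fun i => vote ∘ roundRobin e ht r i with hb
  have hwin : ∀ (x : Fin k → Fin t) (i : Fin k) (w : C),
      IsEpsWinner R 0 (Fin.append (a x) (b i)) w → w = e (i, x i) := by
    intro x i w hw
    rw [isEpsWinner_zero_iff, ha, hb, ← comp_append] at hw
    by_contra hne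
    exact (card_hardStream_lt e he ht hr x i w hne).not_ge (hR _ (hardStream e ht r x i) w hw _)
  obtain ⟨ω, hω⟩ := exists_mul_card_le_sum_indicator μ
    (fun y : (Fin k → Fin t) × Fin k =>
      {ω | A.result (Fin.append (a y.1) (b y.2)) ω = e (y.2, y.1 y.2)})
    (fun y => A.measurableSet_result_eq _ _) (1 - δ)
    (fun y => (hA _).trans (measureReal_mono fun ω hω => hwin _ _ _ hω))
  refine index_lower_bound (fun i c => e (i, c)) (fun i c d h => (Prod.mk.inj (he h)).2)
    (fun x => A.finalMemory (a x) ω)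
    (fun q i => A.output ω
      (Fin.foldl r (fun q j => A.step (k + k + j) ω (b i j) q) q)) (1 - δ) (by simpa using hδ) ?_
  rw [Fintype.sum_prod_type] at hω
  simpa [Set.indicator_apply, OnePassAlgorithm.result_append] using hω

/-- The bound in terms of `min m n`: if this is large compared with `t`, there is room for hard
streams with a word length proportional to it. -/
theorem memory_lower_bound_min {V Ω : Type*} [MeasurableSpace Ω] (μ : Measure Ω)
    [IsProbabilityMeasure μ] {m n : ℕ} (R : VotingRule V (Fin m)) (vote : Fin m → V)
    (hR : ∀ (n : ℕ) (τ : Fin n → Fin m) (w : Fin m),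
      w ∈ R n (vote ∘ τ) → ∀ c, #{i | τ i = c} ≤ #{i | τ i = w})
    {t s : ℕ} (ht : 4 ≤ t) (hmn : 8 * t ≤ min m n) {δ : ℝ} (hδ₁ : δ < 1)
    (hδ : 4 ≤ (1 - δ) * t) (A : OnePassAlgorithm V (Fin m) s Ω)
    (hA : A.SolvesWinnerDetermination μ R n 0 δ) :
    (1 - δ) / (4 * t) * (min m n : ℕ) ≤ s := by
  have hm : min m n ≤ m := min_le_left _ _
  have hn : min m n ≤ n := min_le_right _ _
  generalize min m n = K at hm hn hmn ⊢
  -- Room is needed for `k * t` candidates and for `2 * k + t` votes; since `t ≥ 4` and `k ≥ 8`, both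
  -- numbers are at most `K`.
  obtain ⟨k, hk⟩ : ∃ k, k = K / t := ⟨_, rfl⟩
  have hkt : t * k ≤ K := hk ▸ Nat.mul_div_le K t
  have hkt' : K < t * (k + 1) := by
    rw [hk, mul_add, mul_one]; exact Nat.lt_mul_div_succ K (by omega)
  have hk8 : 8 ≤ k := hk ▸ (Nat.le_div_iff_mul_le (by omega)).2 hmn
  have hkt4 : 4 * k ≤ t * k := Nat.mul_le_mul_right k ht
  obtain ⟨r, rfl⟩ : ∃ r, n = k + k + r := ⟨n - (k + k), by omega⟩
  obtain ⟨e⟩ : Nonempty (Fin k × Fin t ↪ Fin m) :=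
    Function.Embedding.nonempty_of_card_le (by simp; linarith [mul_comm k t])
  have hmain := memory_lower_bound μ R vote hR e e.injective (by omega) (by omega) hδ A hA
  have hKk : (K : ℝ) ≤ t * (2 * k) := by
    have : K ≤ t * (2 * k) := hkt'.le.trans (Nat.mul_le_mul_left t (by omega))
    exact_mod_cast this
  have ht0 : (0 : ℝ) < t := by exact_mod_cast (by omega : 0 < t)
  have hp : 0 < 1 - δ := by linarith
  calc (1 - δ) / (4 * t) * (K : ℝ) ≤ (1 - δ) / (4 * t) * (t * (2 * k)) := by gcongr
    _ = (1 - δ) * k / 2 := by field_simp; ring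
    _ ≤ s := hmain

/-! ### The two voting rules -/

/-- The ranking of `m` candidates that exchanges `c` with candidate `0` puts `c` first. -/
theorem plurality_swap_winner {m : ℕ} (hm : 0 < m) (n : ℕ) (τ : Fin n → Fin m) (w : Fin m)
    (hw : w ∈ plurality m n ((fun c => Equiv.swap ⟨0, hm⟩ c) ∘ τ)) (c : Fin m) :
    #{i | τ i = c} ≤ #{i | τ i = w} := by
  have hscore : ∀ c d : Fin m, ((Equiv.swap ⟨0, hm⟩ d c : Fin m) : ℕ) < 1 ↔ d = c := by
    intro c d
    have h1 : ((Equiv.swap ⟨0, hm⟩ d c : Fin m) : ℕ) < 1 ↔ Equiv.swap ⟨0, hm⟩ d c = ⟨0, hm⟩ := by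
      rw [Fin.ext_iff, Nat.lt_one_iff]
    rw [h1, Equiv.swap_apply_eq_iff, Equiv.swap_apply_left, eq_comm]
  have h := hw c
  simp only [Function.comp_apply, Equiv.symm_swap, hscore, sum_boole] at h
  exact_mod_cast h

theorem generalizedPlurality_approve_winner {m : ℕ} (n : ℕ) (τ : Fin n → Fin m) (w : Fin m)
    (hw : w ∈ generalizedPlurality m n (GenBallot.approve ∘ τ)) (c : Fin m) :
    #{i | τ i = c} ≤ #{i | τ i = w} := by
  have h := hw c
  simpa [Set.ncard_eq_toFinset_card'] using h

end VoteStream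

open VoteStream in
theorem mainTheorem5 (δ : ℝ) (hδ₀ : 0 ≤ δ) (hδ₁ : δ < 1) :
    ∃ c : ℝ, 0 < c ∧ ∃ N₀ : ℕ, ∀ m n : ℕ, N₀ ≤ min m n →
      ∀ (s : ℕ) (Ω : Type*) [MeasurableSpace Ω] (μ : MeasureTheory.Measure Ω)
        [MeasureTheory.IsProbabilityMeasure μ],
        (∀ A : OnePassAlgorithm (Ranking m) (Fin m) s Ω,
          A.SolvesWinnerDetermination μ (plurality m) n 0 δ → c * (min m n : ℕ) ≤ s) ∧
        (∀ A : OnePassAlgorithm (GenBallot m) (Fin m) s Ω,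
          A.SolvesWinnerDetermination μ (generalizedPlurality m) n 0 δ →
            c * (min m n : ℕ) ≤ s) := by
  have hp : 0 < 1 - δ := by linarith
  obtain ⟨t, ht⟩ := exists_nat_ge (4 / (1 - δ))
  have hδ : 4 ≤ (1 - δ) * t := by rwa [div_le_iff₀' hp] at ht
  have ht4 : 4 ≤ t := by
    have : (4 : ℝ) ≤ t := by nlinarith [Nat.cast_nonneg (α := ℝ) t]
    exact_mod_cast this
  have ht0 : (0 : ℝ) < t := by exact_mod_cast (by omega : 0 < t)
  refine ⟨(1 - δ) / (4 * t), by positivity, 8 * t, fun m n hmn s Ω _ μ _ => ⟨?_, ?_⟩⟩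
  · have hm : 0 < m := by have := min_le_left m n; omega
    exact memory_lower_bound_min μ (plurality m) _ (plurality_swap_winner hm) ht4 hmn hδ₁ hδ
  · exact memory_lower_bound_min μ (generalizedPlurality m) _
      generalizedPlurality_approve_winner ht4 hmn hδ₁ hδ
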